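/- Let $X$ be a compactum, i.e. a compact metrizable space. A capacity on $X$ is a function $\gamma:\mathcal P(X)\to[0,+\infty)$ such that (1) $\gamma(\emptyset)=0$, and $A\subseteq B$ implies $\gamma(A)\le\gamma(B)$; (2) $\gamma(\bigcup_n A_n)=\sup_n\gamma(A_n)$ whenever $A_0\subseteq A_1\subseteq\dots$ are subsets of $X$; (3) $\gamma(\bigcap_n K_n)=\inf_n\gamma(K_n)$ whenever $K_0\supseteq K_1\supseteq\dots$ are compact subsets of $X$. It is subadditive if $\gamma(A\cup B)\le\gamma(A)+\gamma(B)$ for all $A,B\subseteq X$, non-atomic if $\gamma(\{x\})=0$ for every $x\in X$, and thin if there is no uncountable family of pairwise disjoint compact subsets of $X$ of positive capacity. For capacities $\gamma',\gamma$ on $X$ write $\gamma'\ll\gamma$ if $\gamma(A)=0$ implies $\gamma'(A)=0$ for every $A\subseteq X$. A $G_{\delta\sigma}$ set is a countable union of $G_\delta$ sets. **Theorem.** Let $\gamma$ be a non-atomic subadditive capacity on a compactum $X$. If $\gamma$ is not thin, then there is a $G_{\delta\sigma}$ set $M$ in $X$ such that: (i) $\gamma(G\setminus M)>0$ for every $G_\delta$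 set $G$ in $X$ containing $M$; (ii) there is a subadditive capacity $\gamma'\ll\gamma$ on $X$ such that $\gamma'(M)=0$, but $M$ is not contained in any $\gamma'$-null $G_\delta$ set in $X$ (that is, $\gamma'(G)>0$ for every $G_\delta$ set $G\supseteq M$). -/

import Mathlib

open scoped NNReal

namespace ChoquetCapacity

/-- A (Choquet) capacity on a topological space `X`: a finite-valued, monotone set function defined
on all subsets of `X`, vanishing on the empty set, continuous along increasing sequences of
arbitrary sets and along decreasing sequences of compact sets. -/
structure IsCapacity {X : Type*} [TopologicalSpace X] (γ : Set X → ℝ≥0) : Prop where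
  empty : γ ∅ = 0
  mono : ∀ A B : Set X, A ⊆ B → γ A ≤ γ B
  iUnion : ∀ A : ℕ → Set X, (∀ n, A n ⊆ A (n + 1)) →
    IsLUB (Set.range fun n => γ (A n)) (γ (⋃ n, A n))
  iInter : ∀ K : ℕ → Set X, (∀ n, IsCompact (K n)) → (∀ n, K (n + 1) ⊆ K n) →
    IsGLB (Set.range fun n => γ (K n)) (γ (⋂ n, K n))

/-- Subadditivity on all pairs of subsets. -/
def IsSubadditive {X : Type*} (γ : Set X → ℝ≥0) : Prop :=
  ∀ A B : Set X, γ (A ∪ B) ≤ γ A + γ B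

/-- A set function is non-atomic if it vanishes at all singletons. -/
def IsNonatomic {X : Type*} (γ : Set X → ℝ≥0) : Prop :=
  ∀ x : X, γ {x} = 0

/-- Thinness: every family of pairwise disjoint compact sets of positive capacity is countable. -/
def IsThin {X : Type*} [TopologicalSpace X] (γ : Set X → ℝ≥0) : Prop :=
  ∀ F : Set (Set X), (∀ K ∈ F, IsCompact K ∧ 0 < γ K) → F.Pairwise Disjoint → F.Countable

/-- Absolute continuity `γ' ≪ γ`: every `γ`-null set is `γ'`-null. -/
def AbsCont {X : Type*} (γ' γ : Set X → ℝ≥0) : Prop :=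
  ∀ A : Set X, γ A = 0 → γ' A = 0

/-- A `G_{δσ}` set: a union of countably many `G_δ` sets. -/
def IsGdeltaSigma {X : Type*} [TopologicalSpace X] (M : Set X) : Prop :=
  ∃ G : ℕ → Set X, (∀ n, IsGδ (G n)) ∧ M = ⋃ n, G n

end ChoquetCapacity

namespace ChoquetCapacity

open Set Filter Topology TopologicalSpace

/-! ### Cantor schemes of sets of large capacity -/

section Scheme

variable {X : Type*} [TopologicalSpace X] [CompactSpace X] [MetrizableSpace X]

/-! If `γ` is not thin, some Cantor scheme of closed sets has all capacities at least some `ε > 0`;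
by continuity along decreasing compacta so do its branches `C_t`, which are disjoint. Then `γ' A =
sup_t γ (A ∩ C_t)` is a subadditive capacity below `γ`, by compactness of `ℕ → Bool`. The set `M` is
diagonal. Each `t` also codes a sequence of closed sets `W_n(t)`, and `M` contains one point of `C_t
∩ W_n(t)` whenever this is nonempty (`exists_isGδ_selector`). Thus `M` is countable on each branch
and `γ' M = 0`. If a `Gδ` set `G ⊇ M` has complement `⋃ W_n(t)`, then `C_t ⊆ G`, since otherwise `M`
would have a point outside `G`. So `γ' G ≥ ε`, and subadditivity gives `γ (G \ M) > 0`. -/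

theorem exists_countable_separating_closed (X : Type*) [TopologicalSpace X] [CompactSpace X]
    [MetrizableSpace X] :
    ∃ 𝓓 : Set (Set X), 𝓓.Countable ∧ (∀ D ∈ 𝓓, IsClosed D) ∧
      ∀ K K' : Set X, IsClosed K → IsClosed K' → Disjoint K K' →
        ∃ D ∈ 𝓓, K ⊆ D ∧ Disjoint D K' := by
  let _ := metrizableSpaceMetric X
  refine ⟨(fun s => closure (⋃₀ s)) '' {s | s ⊆ countableBasis X ∧ s.Finite}, ?_, ?_, ?_⟩
  · refine Countable.image ?_ _
    exact (countable_ofPred_finite_subset (countable_countableBasis X)).mono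
      fun s (hs : s ⊆ _ ∧ s.Finite) => And.symm hs
  · rintro _ ⟨s, -, rfl⟩
    exact isClosed_closure
  · intro K K' hK hK' hd
    obtain ⟨u, hu, hKu, huK'⟩ :=
      normal_exists_closure_subset hK hK'.isOpen_compl hd.subset_compl_right
    obtain ⟨S, hSB, rfl⟩ := (isBasis_countableBasis X).open_eq_sUnion hu
    obtain ⟨s, hsS, hsf, hKs⟩ := hK.isCompact.elim_finite_subcover_image (b := S) (c := id)
      (fun i hi => isOpen_of_mem_countableBasis (hSB hi)) (by simpa [sUnion_eq_biUnion] using hKu)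
    refine ⟨_, ⟨s, ⟨hsS.trans hSB, hsf⟩, rfl⟩, ?_, ?_⟩
    · refine Subset.trans ?_ subset_closure
      simpa [sUnion_eq_biUnion] using hKs
    · exact disjoint_left.2 fun x hx hx' => huK' (closure_mono (sUnion_subset_sUnion hsS) hx) hx'

/-- Countably many separators `D` can discard only countably many members through countable traces,
so two members survive, and every separator around a survivor keeps uncountably many. -/
theorem exists_disjoint_closed_uncountable {F : Set (Set X)} (hF : ∀ K ∈ F, IsClosed K)
    (hdisj : F.Pairwise Disjoint) {C : Set X} (hC : IsClosed C)
    (hunc : ¬ {K ∈ F | K ⊆ C}.Countable) :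
    ∃ C₀ C₁ : Set X, IsClosed C₀ ∧ IsClosed C₁ ∧ C₀ ⊆ C ∧ C₁ ⊆ C ∧ Disjoint C₀ C₁ ∧
      ¬ {K ∈ F | K ⊆ C₀}.Countable ∧ ¬ {K ∈ F | K ⊆ C₁}.Countable := by
  obtain ⟨𝓓, h𝓓, hcl, hsep⟩ := exists_countable_separating_closed X
  set bad : Set (Set X) :=
    ⋃ D ∈ {D ∈ 𝓓 | {K ∈ F | K ⊆ C ∩ D}.Countable}, {K ∈ F | K ⊆ C ∩ D} with hbad
  have hbadc : bad.Countable := (h𝓓.mono (sep_subset _ _)).biUnion fun D hD => hD.2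
  have hns : ¬ ({K ∈ F | K ⊆ C} \ bad).Subsingleton := fun h =>
    hunc ((h.countable.union hbadc).mono fun K hK => by
      by_cases hb : K ∈ bad
      exacts [Or.inr hb, Or.inl ⟨hK, hb⟩])
  obtain ⟨K, ⟨hK, hKb⟩, K', ⟨hK', hKb'⟩, hne⟩ := not_subsingleton_iff.1 hns
  have key : ∀ {K}, K ∈ F → K ⊆ C → K ∉ bad → ∀ D ∈ 𝓓, K ⊆ D →
      ¬ {K ∈ F | K ⊆ C ∩ D}.Countable := fun hK hKC hb D hD hKD hc =>
    hb (mem_biUnion (show D ∈ {D ∈ 𝓓 | {K ∈ F | K ⊆ C ∩ D}.Countable} from ⟨hD, hc⟩)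
      ⟨hK, subset_inter hKC hKD⟩)
  obtain ⟨D, hD, hKD, hDK'⟩ := hsep K K' (hF _ hK.1) (hF _ hK'.1) (hdisj hK.1 hK'.1 hne)
  -- Separating `K'` from `D`, not just from `K`, makes `D` and `D'` disjoint.
  obtain ⟨D', hD', hKD', hDD'⟩ := hsep K' D (hF _ hK'.1) (hcl _ hD) hDK'.symm
  exact ⟨C ∩ D, C ∩ D', hC.inter (hcl _ hD), hC.inter (hcl _ hD'), inter_subset_left,
    inter_subset_left, (hDD'.symm.mono inter_subset_right inter_subset_right),
    key hK.1 hK.2 hKb D hD hKD, key hK'.1 hK'.2 hKb' D' hD' hKD'⟩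

theorem exists_cantorScheme_of_not_isThin {γ : Set X → ℝ≥0} (hcap : IsCapacity γ)
    (hthin : ¬ IsThin γ) :
    ∃ (ε : ℝ≥0) (C : List Bool → Set X), 0 < ε ∧ (∀ l, IsClosed (C l)) ∧ CantorScheme.Antitone C ∧
      CantorScheme.Disjoint C ∧ ∀ l, ε ≤ γ (C l) := by
  simp only [IsThin, not_forall] at hthin
  obtain ⟨F, hF, hdisj, hunc⟩ := hthin
  obtain ⟨n, hn⟩ : ∃ n : ℕ, ¬ {K ∈ F | (1 : ℝ≥0) / (n + 1) ≤ γ K}.Countable := by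
    by_contra! h
    refine hunc ((countable_iUnion h).mono fun K hK => ?_)
    obtain ⟨n, hn⟩ := exists_nat_one_div_lt (hF K hK).2
    exact mem_iUnion.2 ⟨n, hK, hn.le⟩
  set E := {K ∈ F | (1 : ℝ≥0) / (n + 1) ≤ γ K}
  have split : ∀ C : {C : Set X // IsClosed C ∧ ¬ {K ∈ E | K ⊆ C}.Countable},
      ∃ c : Bool → {C : Set X // IsClosed C ∧ ¬ {K ∈ E | K ⊆ C}.Countable},
        (∀ b, (c b : Set X) ⊆ C) ∧ Pairwise fun a b => Disjoint (c a : Set X) (c b) := by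
    rintro ⟨C, hC, hCu⟩
    obtain ⟨C₀, C₁, h₀, h₁, hs₀, hs₁, hd, hu₀, hu₁⟩ := exists_disjoint_closed_uncountable
      (fun K hK => (hF K hK.1).1.isClosed) (hdisj.mono (sep_subset _ _)) hC hCu
    refine ⟨fun b => cond b ⟨C₀, h₀, hu₀⟩ ⟨C₁, h₁, hu₁⟩, ?_, ?_⟩
    · rintro (_ | _) <;> assumption
    · rintro (_ | _) (_ | _) h <;> first | exact absurd rfl h | exact hd | exact hd.symm
  choose c hcs hcd using split
  let C : List Bool → {C : Set X // IsClosed C ∧ ¬ {K ∈ E | K ⊆ C}.Countable} := fun l =>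
    List.rec ⟨univ, isClosed_univ, by simpa using hn⟩ (fun b _ ih => c ih b) l
  refine ⟨1 / (n + 1), fun l => (C l).1, by positivity, fun l => (C l).2.1, fun l b => ?_,
    fun l => ?_, fun l => ?_⟩
  · exact hcs (C l) b
  · exact hcd (C l)
  obtain ⟨K, hK, hKC⟩ : {K ∈ E | K ⊆ (C l).1}.Nonempty := by
    by_contra h
    exact (C l).2.2 (by simp [not_nonempty_iff_eq_empty.1 h])
  exact hK.2.trans (hcap.mono _ _ hKC)

end Scheme

/-! ### Lexicographically minimal selectors -/

section Selector

/-- Minimize `φ 0`, then `φ 1` among the minimizers, and so on; the nested nonempty compacta `K k`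
have a common point. -/
theorem exists_lexMin {X : Type*} [TopologicalSpace X] {φ : ℕ → X → ℝ} (hφ : ∀ k, Continuous (φ k))
    {A : Set X} (hA : IsCompact A) (hcl : IsClosed A) (hne : A.Nonempty) :
    ∃ x ∈ A, ∀ y ∈ A, ∀ k, (∀ i < k, φ i y = φ i x) → φ k x ≤ φ k y := by
  let K : ℕ → Set X := fun n =>
    Nat.rec A (fun k S => S ∩ {x | ∀ y ∈ S, φ k x ≤ φ k y}) n
  have hKs : ∀ k, K (k + 1) = K k ∩ {x | ∀ y ∈ K k, φ k x ≤ φ k y} := fun k => rfl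
  have hKc : ∀ k, IsCompact (K k) ∧ IsClosed (K k) ∧ (K k).Nonempty := by
    intro k
    induction k with
    | zero => exact ⟨hA, hcl, hne⟩
    | succ k ih =>
      have hc : IsClosed {x | ∀ y ∈ K k, φ k x ≤ φ k y} := by
        simp only [ofPred_forall]
        exact isClosed_biInter fun y _ => isClosed_le (hφ k) continuous_const
      obtain ⟨x, hx, hmin⟩ := ih.1.exists_isMinOn ih.2.2 (hφ k).continuousOn
      rw [hKs]
      exact ⟨ih.1.inter_right hc, ih.2.1.inter hc, x, hx, fun y hy => hmin hy⟩
  obtain ⟨x, hx⟩ := IsCompact.nonempty_iInter_of_sequence_nonempty_isCompact_isClosed K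
    (fun k => inter_subset_left) (fun k => (hKc k).2.2) hA (fun k => (hKc k).2.1)
  rw [mem_iInter] at hx
  refine ⟨x, hx 0, fun y hy k hk => ?_⟩
  have hyK : ∀ i ≤ k, y ∈ K i := by
    intro i
    induction i with
    | zero => exact fun _ => hy
    | succ i ih =>
      intro hi
      refine ⟨ih (by omega), fun z hz => ?_⟩
      rw [hk i (by omega)]
      exact (hx (i + 1)).2 z hz
  exact (hx (k + 1)).2 y (hyK k le_rfl)

theorem exists_continuous_separating (X : Type*) [TopologicalSpace X] [CompactSpace X]
    [MetrizableSpace X] :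
    ∃ φ : ℕ → X → ℝ, (∀ k, Continuous (φ k)) ∧ ∀ x y, (∀ k, φ k x = φ k y) → x = y := by
  let _ := metrizableSpaceMetric X
  rcases isEmpty_or_nonempty X with h | h
  · exact ⟨fun _ _ => 0, fun _ => continuous_const, fun x => (h.false x).elim⟩
  refine ⟨fun k x => dist x (denseSeq X k), fun k => by fun_prop, fun x y hxy => ?_⟩
  have : (fun z => dist x z) = fun z => dist y z :=
    (denseRange_denseSeq X).equalizer (by fun_prop) (by fun_prop) (funext hxy)
  simpa using congrFun this y

/-- A closed subset of `X × T` with pairwise disjoint horizontal sections admits a `Gδ` set meeting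
each nonempty section in exactly one point. -/
theorem exists_isGδ_selector {X T : Type*} [TopologicalSpace X] [CompactSpace X]
    [MetrizableSpace X] [TopologicalSpace T] [CompactSpace T] {F : Set (X × T)} (hF : IsClosed F)
    (hdisj : ∀ x t t', (x, t) ∈ F → (x, t') ∈ F → t = t') :
    ∃ M : Set X, IsGδ M ∧ (∀ x ∈ M, ∃ t, (x, t) ∈ F) ∧
      (∀ t, {x ∈ M | (x, t) ∈ F}.Subsingleton) ∧
      ∀ t, (∃ x, (x, t) ∈ F) → ∃ x ∈ M, (x, t) ∈ F := by
  let _ := metrizableSpaceMetric X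
  obtain ⟨φ, hφ, hsep⟩ := exists_continuous_separating X
  let M : Set X := {x | ∃ t, (x, t) ∈ F ∧
    ∀ y, (y, t) ∈ F → ∀ k, (∀ i < k, φ i y = φ i x) → φ k x ≤ φ k y}
  -- `B (k, m)` records a failure of minimality at coordinate `k` by a margin `1 / (m + 1)`. The
  -- margin keeps it closed, so `M` is a closed set minus countably many compact projections.
  let B : ℕ × ℕ → Set (X × T × X) := fun p =>
    {q | (q.1, q.2.1) ∈ F ∧ (q.2.2, q.2.1) ∈ F ∧ (∀ i < p.1, φ i q.2.2 = φ i q.1) ∧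
      φ p.1 q.2.2 + 1 / ((p.2 : ℝ) + 1) ≤ φ p.1 q.1}
  have hB : ∀ p, IsClosed (B p) := by
    intro p
    have h₁ : IsClosed {q : X × T × X | ∀ i < p.1, φ i q.2.2 = φ i q.1} := by
      simp only [ofPred_forall]
      exact isClosed_biInter fun i _ => isClosed_eq ((hφ i).comp (by fun_prop))
        ((hφ i).comp (by fun_prop))
    have h₂ : IsClosed {q : X × T × X | φ p.1 q.2.2 + 1 / ((p.2 : ℝ) + 1) ≤ φ p.1 q.1} :=
      isClosed_le (((hφ _).comp (by fun_prop)).add continuous_const) ((hφ _).comp (by fun_prop))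
    have h₃ : IsClosed {q : X × T × X | (q.1, q.2.1) ∈ F} := hF.preimage (by fun_prop)
    have h₄ : IsClosed {q : X × T × X | (q.2.2, q.2.1) ∈ F} := hF.preimage (by fun_prop)
    exact h₃.inter (h₄.inter (h₁.inter h₂))
  have hM : M = Prod.fst '' F ∩ ⋂ p, (Prod.fst '' B p)ᶜ := by
    ext x
    constructor
    · rintro ⟨t, hxt, hmin⟩
      refine ⟨⟨_, hxt, rfl⟩, mem_iInter.2 fun p => ?_⟩
      rintro ⟨⟨x', t', y⟩, ⟨h₁, h₂, h₃, h₄⟩, rfl⟩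
      obtain rfl := hdisj _ _ _ hxt h₁
      have := hmin y h₂ p.1 h₃
      have hpos : 0 < 1 / ((p.2 : ℝ) + 1) := by positivity
      simp only at h₄ this
      linarith
    · rintro ⟨⟨⟨x', t⟩, hxt, rfl⟩, hx⟩
      refine ⟨t, hxt, fun y hy k hk => ?_⟩
      by_contra! hlt
      obtain ⟨m, hm⟩ := exists_nat_one_div_lt (sub_pos.2 hlt)
      refine mem_iInter.1 hx (k, m) ⟨(x', t, y), ⟨hxt, hy, hk, ?_⟩, rfl⟩
      simp only at hm ⊢
      linarith
  refine ⟨M, ?_, fun x ⟨t, ht, _⟩ => ⟨t, ht⟩, ?_, ?_⟩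
  · rw [hM]
    exact (hF.isCompact.image continuous_fst).isClosed.isGδ.inter (IsGδ.iInter_of_isOpen fun p =>
      ((hB p).isCompact.image continuous_fst).isClosed.isOpen_compl)
  · rintro t x ⟨⟨t₁, hx, hxm⟩, hxt⟩ y ⟨⟨t₂, hy, hym⟩, hyt⟩
    obtain rfl := hdisj _ _ _ hx hxt
    obtain rfl := hdisj _ _ _ hy hyt
    refine hsep x y fun k => ?_
    induction k using Nat.strong_induction_on with
    | _ k ih =>
      exact le_antisymm (hxm y hyt k fun i hi => (ih i hi).symm) (hym x hxt k fun i hi => ih i hi)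
  · rintro t ⟨x₀, hx₀⟩
    have hcl : IsClosed {x | (x, t) ∈ F} := hF.preimage (by fun_prop)
    obtain ⟨x, hx, hmin⟩ := exists_lexMin hφ hcl.isCompact hcl ⟨x₀, hx₀⟩
    exact ⟨x, ⟨t, hx, hmin⟩, hx⟩

end Selector

/-! ### The supremum capacity of a Cantor scheme -/

/-- The intersection of a Cantor scheme along a branch. -/
def branch {X : Type*} (C : List Bool → Set X) (t : ℕ → Bool) : Set X :=
  ⋂ n, C (PiNat.res t n)

/-- The largest `γ`-capacity of the trace of a set on a branch of the scheme `C`. -/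
noncomputable def branchSup {X : Type*} (γ : Set X → ℝ≥0) (C : List Bool → Set X) (A : Set X) :
    ℝ≥0 :=
  ⨆ t, γ (A ∩ branch C t)

section Branch

variable {X : Type*} {C : List Bool → Set X}

theorem branch_disjoint (hdisj : CantorScheme.Disjoint C)
    {x : X} {s t : ℕ → Bool} (hs : x ∈ branch C s) (ht : x ∈ branch C t) : s = t := by
  simp only [branch, mem_iInter] at hs ht
  refine PiNat.res_injective (funext fun n => ?_)
  induction n with
  | zero => rfl
  | succ n ih =>
    have h₁ := hs (n + 1)
    have h₂ := ht (n + 1)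
    rw [PiNat.res_succ] at h₁ h₂ ⊢
    rw [PiNat.res_succ, ih]
    rw [ih] at h₁
    by_contra hne
    exact disjoint_left.1 (hdisj _ fun h => hne (by rw [h])) h₁ h₂

theorem isClopen_setOf_res (P : List Bool → Prop) (n : ℕ) :
    IsClopen {t : ℕ → Bool | P (PiNat.res t n)} := by
  have key : ∀ Q : List Bool → Prop, IsOpen {t : ℕ → Bool | Q (PiNat.res t n)} := fun Q => by
    refine isOpen_iff_mem_nhds.2 fun t ht => ?_
    refine mem_of_superset ((PiNat.isOpen_cylinder (fun _ => Bool) t n).mem_nhds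
      (PiNat.self_mem_cylinder t n)) fun s hs => ?_
    rw [PiNat.cylinder_eq_res] at hs
    have hs : PiNat.res s n = PiNat.res t n := hs
    change Q _
    rw [hs]
    exact ht
  exact ⟨⟨by simpa [compl_def] using key fun l => ¬ P l⟩, key P⟩

theorem isClosed_branch_rel [TopologicalSpace X] (hcl : ∀ l, IsClosed (C l)) :
    IsClosed {p : X × (ℕ → Bool) | p.1 ∈ branch C p.2} := by
  simp only [branch, mem_iInter, ofPred_forall]
  refine isClosed_iInter fun n => ⟨isOpen_iff_mem_nhds.2 ?_⟩
  rintro ⟨x, t⟩ hx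
  have h₁ := (hcl (PiNat.res t n)).isOpen_compl.mem_nhds hx
  have h₂ := (isClopen_setOf_res (fun l => l = PiNat.res t n) n).isOpen.mem_nhds
    (show t ∈ {s : ℕ → Bool | PiNat.res s n = PiNat.res t n} from rfl)
  refine mem_of_superset (prod_mem_nhds h₁ h₂) ?_
  rintro ⟨y, s⟩ ⟨hy, hs⟩
  have hs : PiNat.res s n = PiNat.res t n := hs
  change y ∉ C _
  rw [hs]
  exact hy

end Branch

section BranchSup

variable {X : Type*} [TopologicalSpace X] {γ : Set X → ℝ≥0} {C : List Bool → Set X}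

/-- Each condition on the right depends on finitely many bits of `t`, so superlevel sets in `t` are
closed. -/
theorem IsCapacity.le_inter_branch_iff [CompactSpace X] (hcap : IsCapacity γ)
    (hcl : ∀ l, IsClosed (C l)) (hanti : CantorScheme.Antitone C) {A : Set X} (hA : IsCompact A)
    {b : ℝ≥0} (t : ℕ → Bool) :
    b ≤ γ (A ∩ branch C t) ↔ ∀ n, b ≤ γ (A ∩ C (PiNat.res t n)) := by
  have h := hcap.iInter (fun n => A ∩ C (PiNat.res t n)) (fun n => hA.inter_right (hcl _))
    fun n => inter_subset_inter_right _ (hanti _ _)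
  rw [← inter_iInter] at h
  rw [branch, le_isGLB_iff h, mem_lowerBounds, forall_mem_range]

theorem IsCapacity.bddAbove_branch (hcap : IsCapacity γ) (A : Set X) :
    BddAbove (range fun t => γ (A ∩ branch C t)) :=
  ⟨γ A, forall_mem_range.2 fun _ => hcap.mono _ _ inter_subset_left⟩

theorem IsCapacity.le_branchSup (hcap : IsCapacity γ) (A : Set X) (t : ℕ → Bool) :
    γ (A ∩ branch C t) ≤ branchSup γ C A :=
  le_ciSup (hcap.bddAbove_branch A) t

theorem IsCapacity.branchSup_le (hcap : IsCapacity γ) (A : Set X) : branchSup γ C A ≤ γ A :=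
  ciSup_le fun _ => hcap.mono _ _ inter_subset_left

theorem IsCapacity.branchSup_isCapacity [CompactSpace X] [T2Space X] (hcap : IsCapacity γ)
    (hcl : ∀ l, IsClosed (C l)) (hanti : CantorScheme.Antitone C) :
    IsCapacity (branchSup γ C) := by
  have mono : ∀ A B : Set X, A ⊆ B → branchSup γ C A ≤ branchSup γ C B := fun A B h =>
    ciSup_le fun t => (hcap.mono _ _ (inter_subset_inter_left _ h)).trans (hcap.le_branchSup B t)
  refine ⟨?_, mono, ?_, ?_⟩
  · simp [branchSup, hcap.empty]
  · refine fun A hA => ⟨forall_mem_range.2 fun n => mono _ _ (subset_iUnion A n), fun b hb => ?_⟩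
    refine ciSup_le fun t => ?_
    have h := hcap.iUnion (fun n => A n ∩ branch C t) fun n => inter_subset_inter_left _ (hA n)
    rw [← iUnion_inter] at h
    exact h.2 (forall_mem_range.2 fun n => (hcap.le_branchSup _ t).trans (hb ⟨n, rfl⟩))
  · refine fun K hK hKanti => ⟨forall_mem_range.2 fun n => mono _ _ (iInter_subset K n),
      fun b hb => ?_⟩
    by_contra! hlt
    -- The supremum need not be known to be attained at `b`; a level `c < b` makes every `T n`
    -- nonempty.
    obtain ⟨c, hc, hcb⟩ := exists_between hlt
    let T : ℕ → Set (ℕ → Bool) := fun n => {t | c ≤ γ (K n ∩ branch C t)}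
    have hTcl : ∀ n, IsClosed (T n) := fun n => by
      simp only [T, hcap.le_inter_branch_iff hcl hanti (hK n), ofPred_forall]
      exact isClosed_iInter fun k => (isClopen_setOf_res (fun l => c ≤ γ (K n ∩ C l)) k).isClosed
    obtain ⟨t, ht⟩ := IsCompact.nonempty_iInter_of_sequence_nonempty_isCompact_isClosed T
      (fun n t ht => le_trans (show c ≤ γ (K (n + 1) ∩ branch C t) from ht)
        (hcap.mono _ _ (inter_subset_inter_left _ (hKanti n))))
      (fun n => by
        obtain ⟨t, ht⟩ := exists_lt_of_lt_ciSup (hcb.trans_le (hb ⟨n, rfl⟩))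
        exact ⟨t, ht.le⟩)
      (hTcl 0).isCompact hTcl
    have hbr : IsClosed (branch C t) := isClosed_iInter fun n => hcl _
    have h := hcap.iInter (fun n => K n ∩ branch C t) (fun n => (hK n).inter_right hbr)
      fun n => inter_subset_inter_left _ (hKanti n)
    rw [← iInter_inter] at h
    exact absurd ((h.2 (forall_mem_range.2 fun n => mem_iInter.1 ht n)).trans
      (hcap.le_branchSup _ t)) (not_le.2 hc)

theorem IsCapacity.branchSup_isSubadditive (hcap : IsCapacity γ) (hsub : IsSubadditive γ) :
    IsSubadditive (branchSup γ C) := fun A B => ciSup_le fun t => by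
  rw [union_inter_distrib_right]
  exact (hsub _ _).trans (add_le_add (hcap.le_branchSup A t) (hcap.le_branchSup B t))

end BranchSup

section Null

variable {X : Type*} [TopologicalSpace X] {γ : Set X → ℝ≥0}

theorem IsCapacity.eq_zero_of_countable (hcap : IsCapacity γ) (hsub : IsSubadditive γ)
    (hna : IsNonatomic γ) {A : Set X} (hA : A.Countable) : γ A = 0 := by
  rcases A.eq_empty_or_nonempty with rfl | hne
  · exact hcap.empty
  obtain ⟨f, rfl⟩ := hA.exists_eq_range hne
  have hfin : ∀ n, γ (f '' Iio n) = 0 := by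
    intro n
    induction n with
    | zero => simp [hcap.empty]
    | succ n ih =>
      have h : f '' Iio (n + 1) = f '' Iio n ∪ {f n} := by
        rw [← image_singleton, ← image_union]
        congr 1
        ext i
        simp
      rw [h]
      exact le_antisymm ((hsub _ _).trans (by simp [ih, hna (f n)])) zero_le
  have h := hcap.iUnion (fun n => f '' Iio n) fun n => image_mono (Iio_subset_Iio n.le_succ)
  have hU : ⋃ n, f '' Iio n = range f := by
    rw [← image_iUnion, ← image_univ]
    congr 1
    exact eq_univ_of_forall fun i => mem_iUnion.2 ⟨i + 1, i.lt_succ_self⟩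
  rw [hU] at h
  exact le_antisymm (h.2 (forall_mem_range.2 fun n => (hfin n).le)) zero_le

end Null

/-! ### Universal closed sets and the diagonal set -/

/-- The sections of a suitable sequence of closed subsets of `X × (ℕ → Bool)` run through all
sequences of closed subsets of `X`. -/
theorem exists_universal_isClosed (X : Type*) [TopologicalSpace X] [SecondCountableTopology X] :
    ∃ W : ℕ → Set (X × (ℕ → Bool)), (∀ n, IsClosed (W n)) ∧
      ∀ D : ℕ → Set X, (∀ n, IsClosed (D n)) → ∃ t, ∀ n x, (x, t) ∈ W n ↔ x ∈ D n := by
  classical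
  -- Inserting `∅` makes the family nonempty, hence enumerable, even when `X` is empty.
  obtain ⟨b, hb⟩ := ((countable_countableBasis X).insert ∅).exists_eq_range (insert_nonempty _ _)
  have hbo : ∀ i, IsOpen (b i) := fun i => by
    rcases hb.symm ▸ mem_range_self i with h | h
    · rw [h]
      exact isOpen_empty
    · exact isOpen_of_mem_countableBasis h
  -- Bit `Nat.pair n i` of the code tells whether `b i` is removed from the `n`-th section.
  refine ⟨fun n => {p | ∀ i, p.2 (Nat.pair n i) = true → p.1 ∉ b i}, fun n => ?_, fun D hD => ?_⟩
  · simp only [ofPred_forall, imp_iff_not_or, Bool.not_eq_true]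
    refine isClosed_iInter fun i => IsClosed.union ?_ ?_
    · exact isClosed_eq (by fun_prop) continuous_const
    · exact (hbo i).isClosed_compl.preimage continuous_fst
  · refine ⟨fun m => decide (Disjoint (b m.unpair.2) (D m.unpair.1)), fun n x => ?_⟩
    simp only [mem_ofPred, Nat.unpair_pair, decide_eq_true_eq]
    refine ⟨fun h => ?_, fun hx i hi hxi => disjoint_left.1 hi hxi hx⟩
    by_contra hx
    obtain ⟨v, hv, hxv, hvD⟩ := (isBasis_countableBasis X).exists_subset_of_mem_open
      (show x ∈ (D n)ᶜ from hx) (hD n).isOpen_compl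
    obtain ⟨i, rfl⟩ : v ∈ range b := hb ▸ mem_insert_of_mem _ hv
    exact h i (subset_compl_iff_disjoint_right.1 hvD) hxv

section Diagonal

variable {X : Type*} [TopologicalSpace X] [CompactSpace X] [MetrizableSpace X]

/-- A diagonal set: it has at most countably many points on each branch, and every `Gδ` superset
contains a whole branch. -/
theorem exists_diagonal_isGdeltaSigma {C : List Bool → Set X} (hcl : ∀ l, IsClosed (C l))
    (hdisj : CantorScheme.Disjoint C) :
    ∃ M : Set X, IsGdeltaSigma M ∧ (∀ t, (M ∩ branch C t).Countable) ∧
      ∀ G, IsGδ G → M ⊆ G → ∃ t, branch C t ⊆ G := by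
  let _ := metrizableSpaceMetric X
  obtain ⟨W, hW, huniv⟩ := exists_universal_isClosed X
  have hF : ∀ n, IsClosed ({p : X × (ℕ → Bool) | p.1 ∈ branch C p.2} ∩ W n) := fun n =>
    (isClosed_branch_rel hcl).inter (hW n)
  choose M hM hMF hMs hMne using fun n => exists_isGδ_selector (hF n)
    fun x s t hs ht => branch_disjoint hdisj hs.1 ht.1
  refine ⟨⋃ n, M n, ⟨M, hM, rfl⟩, fun t => ?_, fun G hG hMG => ?_⟩
  · rw [iUnion_inter]
    refine countable_iUnion fun n => ((hMs n t).anti ?_).countable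
    rintro x ⟨hx, hxt⟩
    obtain ⟨s, hs⟩ := hMF n x hx
    obtain rfl := branch_disjoint hdisj hs.1 hxt
    exact ⟨hx, hs⟩
  · obtain ⟨U, hU, rfl⟩ := isGδ_iff_eq_iInter_nat.1 hG
    obtain ⟨t, ht⟩ := huniv (fun n => (U n)ᶜ) fun n => (hU n).isClosed_compl
    refine ⟨t, fun x hx => mem_iInter.2 fun n => ?_⟩
    by_contra hxU
    obtain ⟨y, hyM, -, hyW⟩ := hMne n t ⟨x, hx, (ht n x).2 hxU⟩
    exact (ht n y).1 hyW (mem_iInter.1 (hMG (mem_iUnion_of_mem n hyM)) n)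

end Diagonal

end ChoquetCapacity

theorem theorem1p2 {X : Type*} [TopologicalSpace X] [CompactSpace X]
    [TopologicalSpace.MetrizableSpace X] (γ : Set X → ℝ≥0)
    (hcap : ChoquetCapacity.IsCapacity γ) (hsub : ChoquetCapacity.IsSubadditive γ)
    (hna : ChoquetCapacity.IsNonatomic γ) (hthin : ¬ ChoquetCapacity.IsThin γ) :
    ∃ M : Set X, ChoquetCapacity.IsGdeltaSigma M ∧
      (∀ G : Set X, IsGδ G → M ⊆ G → 0 < γ (G \ M)) ∧
      ∃ γ' : Set X → ℝ≥0, ChoquetCapacity.IsCapacity γ' ∧ ChoquetCapacity.IsSubadditive γ' ∧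
        ChoquetCapacity.AbsCont γ' γ ∧ γ' M = 0 ∧
        ¬ ∃ G : Set X, IsGδ G ∧ M ⊆ G ∧ γ' G = 0 := by
  obtain ⟨ε, C, hε, hcl, hanti, hdisj, hγC⟩ :=
    ChoquetCapacity.exists_cantorScheme_of_not_isThin hcap hthin
  obtain ⟨M, hM, hMc, hMG⟩ := ChoquetCapacity.exists_diagonal_isGdeltaSigma hcl hdisj
  have hcap' := hcap.branchSup_isCapacity hcl hanti
  have hsub' := hcap.branchSup_isSubadditive (C := C) hsub
  have hM0 : ChoquetCapacity.branchSup γ C M = 0 := by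
    simp [ChoquetCapacity.branchSup, hcap.eq_zero_of_countable hsub hna (hMc _)]
  have hbranch : ∀ t, ε ≤ γ (ChoquetCapacity.branch C t) := fun t => by
    simpa using (hcap.le_inter_branch_iff hcl hanti isCompact_univ t).2
      fun n => by simpa using hγC _
  have hpos : ∀ G, IsGδ G → M ⊆ G → 0 < ChoquetCapacity.branchSup γ C G := by
    intro G hG hMsub
    obtain ⟨t, ht⟩ := hMG G hG hMsub
    refine hε.trans_le ((hbranch t).trans ?_)
    rw [← Set.inter_eq_right.2 ht]
    exact hcap.le_branchSup G t
  refine ⟨M, hM, fun G hG hMsub => ?_, ChoquetCapacity.branchSup γ C, hcap', hsub', ?_, hM0, ?_⟩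
  · refine lt_of_lt_of_le ?_ (hcap.branchSup_le (C := C) _)
    have h := hsub' (G \ M) M
    rw [Set.sdiff_union_of_subset hMsub, hM0, add_zero] at h
    exact (hpos G hG hMsub).trans_le h
  · exact fun A hA => le_antisymm ((hcap.branchSup_le A).trans hA.le) zero_le
  · rintro ⟨G, hG, hMsub, hG0⟩
    exact (hpos G hG hMsub).ne' hG0
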